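/- Let $M$ be a (Hausdorff) smooth manifold and $E\to M$ a smooth real vector bundle of finite rank. The gauge Lie algebroid $\mathfrak{D}E$ has as fibre at $m\in M$ the space of pairs $(\mathfrak d,x)$, where $x\in T_mM$ and $\mathfrak d:\Gamma(E)\to E_m$ is $\mathbb R$-linear with $\mathfrak d(fu)=f(m)\,\mathfrak d(u)+x(f)\,u(m)$ for all $f\in C^\infty(M)$, $u\in\Gamma(E)$ ($x$ is determined by $\mathfrak d$ if $E_m\neq0$); the anchor is $\alpha(\mathfrak d,x)=x$, and $\mathfrak{gl}(E_m)\subset(\mathfrak DE)_m$ by $\Phi\mapsto(u\mapsto\Phi(u(m)),0)$. $\Gamma(\mathfrak DE)$ consists of the families $\mathfrak d=(\mathfrak d_m)_m$ that map smooth sections of $E$ to smooth sections and have smooth anchor; its bracket $[\cdot,\cdot]_{\mathfrak D}$ is the commutator of operators on $\Gamma(E)$, with anchor the Lie bracket of the anchors. The (first) jet bundle $\mathfrak JE$ has as fibre at $m$ the space of linear maps $\mu:(\mathfrak DE)_m\to E_m$ with $\mu(\Phi)=\Phi(\mu(\mathbf 1_{E_m}))$ for all $\Phi\in\mathfrak{gl}(E_m)$;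 $\Gamma(\mathfrak JE)$ consists of the families $\mu$ for which $\langle\mu,\mathfrak d\rangle_E:=\mu(\mathfrak d)$ is a smooth section of $E$ for every $\mathfrak d\in\Gamma(\mathfrak DE)$. For $u\in\Gamma(E)$ let $\mathbb d u\in\Gamma(\mathfrak JE)$ be given by $\langle\mathbb d u,\mathfrak d\rangle_E=\mathfrak d(u)$. Then for $\mathfrak d\in\Gamma(\mathfrak DE)$ and $\mu\in\Gamma(\mathfrak JE)$ there is a unique $\mathfrak L_{\mathfrak d}\mu\in\Gamma(\mathfrak JE)$ with $$\langle\mathfrak L_{\mathfrak d}\mu,\mathfrak r\rangle_E=\mathfrak d\langle\mu,\mathfrak r\rangle_E-\langle\mu,[\mathfrak d,\mathfrak r]_{\mathfrak D}\rangle_E\qquad\text{for all }\mathfrak r\in\Gamma(\mathfrak DE).$$ Let $\mathcal E=\mathfrak DE\oplus\mathfrak JE$, let $\rho:\mathcal E\to\mathfrak DE$ be the projection, and for $\mathfrak d,\mathfrak r\in\Gamma(\mathfrak DE)$, $\mu,\nu\in\Gamma(\mathfrak JE)$ put $$(\mathfrak d+\mu,\mathfrak r+\nu)_E=\tfrac12\big(\langle\nu,\mathfrak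 d\rangle_E+\langle\mu,\mathfrak r\rangle_E\big),\qquad \{\mathfrak d+\mu,\mathfrak r+\nu\}=[\mathfrak d,\mathfrak r]_{\mathfrak D}+\mathfrak L_{\mathfrak d}\nu-\mathfrak L_{\mathfrak r}\mu+\mathbb d\langle\mu,\mathfrak r\rangle_E .$$ Then for all $X,Y,Z\in\Gamma(\mathcal E)$ and $f\in C^\infty(M)$: 1. $(\Gamma(\mathcal E),\{\cdot,\cdot\})$ is a Leibniz algebra, i.e. $\{\cdot,\cdot\}$ is $\mathbb R$-bilinear and $\{X,\{Y,Z\}\}=\{\{X,Y\},Z\}+\{Y,\{X,Z\}\}$; 2. $\rho\{X,Y\}=[\rho(X),\rho(Y)]_{\mathfrak D}$; 3. $\{X,fY\}=f\{X,Y\}+\big((\alpha\circ\rho(X))(f)\big)Y$; 4. $\{X,X\}=\mathbb d\,(X,X)_E$; 5. $\rho(X)(Y,Z)_E=(\{X,Y\},Z)_E+(Y,\{X,Z\})_E$. -/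

import Mathlib

open Bundle VectorField Filter
open scoped Manifold ContDiff Topology

namespace OmniLie

section

variable {EM : Type*} [NormedAddCommGroup EM] [NormedSpace ℝ EM]
  {M : Type*} [TopologicalSpace M] [ChartedSpace EM M] [IsManifold 𝓘(ℝ, EM) ∞ M]

/-- The derivative of a smooth function along a smooth vector field is smooth. -/
theorem contMDiff_mvfderiv_apply (f : C^∞⟮𝓘(ℝ, EM), M; ℝ⟯)
    {X : ∀ m : M, TangentSpace 𝓘(ℝ, EM) m}
    (hX : ContMDiff 𝓘(ℝ, EM) 𝓘(ℝ, EM).tangent ∞ (fun m => (⟨m, X m⟩ : TangentBundle 𝓘(ℝ, EM) M))) :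
    ContMDiff 𝓘(ℝ, EM) 𝓘(ℝ, ℝ) ∞ (fun m => mvfderiv 𝓘(ℝ, EM) f m (X m)) := by
  have h := (f.contMDiff.contMDiff_tangentMap (m := ∞) (by simp)).comp hX
  exact (contMDiff_snd_tangentBundle_modelSpace ℝ 𝓘(ℝ, ℝ)).comp h

/-- `[X, Y](f) = X(Y(f)) - Y(X(f))`. -/
theorem mvfderiv_mlieBracket [FiniteDimensional ℝ EM] (f : C^∞⟮𝓘(ℝ, EM), M; ℝ⟯)
    {X Y : ∀ m : M, TangentSpace 𝓘(ℝ, EM) m}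
    (hX : ContMDiff 𝓘(ℝ, EM) 𝓘(ℝ, EM).tangent ∞ (fun m => (⟨m, X m⟩ : TangentBundle 𝓘(ℝ, EM) M)))
    (hY : ContMDiff 𝓘(ℝ, EM) 𝓘(ℝ, EM).tangent ∞ (fun m => (⟨m, Y m⟩ : TangentBundle 𝓘(ℝ, EM) M)))
    (m : M) :
    mvfderiv 𝓘(ℝ, EM) f m (mlieBracket 𝓘(ℝ, EM) X Y m) =
      mvfderiv 𝓘(ℝ, EM) (fun p => mvfderiv 𝓘(ℝ, EM) f p (Y p)) m (X m) -
        mvfderiv 𝓘(ℝ, EM) (fun p => mvfderiv 𝓘(ℝ, EM) f p (X p)) m (Y m) := by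
  have := FiniteDimensional.complete ℝ EM
  rcases subsingleton_or_nontrivial EM with hE | hE
  · have h0 : ∀ v : TangentSpace 𝓘(ℝ, EM) m, v = 0 := fun v => Subsingleton.elim (α := EM) _ _
    rw [h0 (mlieBracket 𝓘(ℝ, EM) X Y m), h0 (X m), h0 (Y m)]
    simp
  obtain ⟨v, hv⟩ := exists_ne (0 : EM)
  let v' : TangentSpace 𝓘(ℝ, EM) m := v
  let Z : ∀ p : M, TangentSpace 𝓘(ℝ, EM) p := FiberBundle.extend EM v'
  have h3 : (minSmoothness ℝ 3) ≤ (∞ : ℕ∞ω) := by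
    rw [minSmoothness_of_isRCLikeNormedField]; exact WithTop.coe_le_coe.2 (le_top : (3 : ℕ∞) ≤ ⊤)
  have h2 : (minSmoothness ℝ 2) ≤ (∞ : ℕ∞ω) := by
    rw [minSmoothness_of_isRCLikeNormedField]; exact WithTop.coe_le_coe.2 (le_top : (2 : ℕ∞) ≤ ⊤)
  have : IsManifold 𝓘(ℝ, EM) (minSmoothness ℝ 3) M := IsManifold.of_le h3
  have : IsManifold 𝓘(ℝ, EM) (((⊤ : ℕ∞) : ℕ∞ω) + 1) M := by simpa
  obtain ⟨s, hs, hZs⟩ := FiberBundle.exists_contMDiffOn_extend (I := 𝓘(ℝ, EM)) (k := ∞) EM v'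
  have hZn : ∀ᶠ p in 𝓝 m, ContMDiffAt 𝓘(ℝ, EM) 𝓘(ℝ, EM).tangent ∞
      (fun m => (⟨m, Z m⟩ : TangentBundle 𝓘(ℝ, EM) M)) p := by
    filter_upwards [eventually_mem_nhds_iff.2 hs] with p hp
    exact hZs.contMDiffAt hp
  have hZ := hZn.self_of_nhds
  have hZv : Z m ≠ 0 := by
    have : Z m = v' := FiberBundle.extend_apply_self EM v'
    rw [this]; exact hv
  have hb : ∀ {U W : ∀ p : M, TangentSpace 𝓘(ℝ, EM) p} {p : M},
      ContMDiffAt 𝓘(ℝ, EM) 𝓘(ℝ, EM).tangent ∞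
        (fun m => (⟨m, U m⟩ : TangentBundle 𝓘(ℝ, EM) M)) p →
      ContMDiffAt 𝓘(ℝ, EM) 𝓘(ℝ, EM).tangent ∞
        (fun m => (⟨m, W m⟩ : TangentBundle 𝓘(ℝ, EM) M)) p →
      ContMDiffAt 𝓘(ℝ, EM) 𝓘(ℝ, EM).tangent ∞
        (fun m => (⟨m, mlieBracket 𝓘(ℝ, EM) U W m⟩ : TangentBundle 𝓘(ℝ, EM) M)) p := by
    intro U W p hU hW
    exact ContMDiffAt.mlieBracket_vectorField (m := ⊤) (n := ⊤) hU hW (by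
      rw [minSmoothness_of_isRCLikeNormedField]; simp)
  have hf : ∀ p, MDifferentiableAt 𝓘(ℝ, EM) 𝓘(ℝ, ℝ) f p := fun p => f.mdifferentiableAt
  have hd : ∀ {U : ∀ p : M, TangentSpace 𝓘(ℝ, EM) p} {p : M},
      ContMDiffAt 𝓘(ℝ, EM) 𝓘(ℝ, EM).tangent ∞
        (fun m => (⟨m, U m⟩ : TangentBundle 𝓘(ℝ, EM) M)) p →
      MDifferentiableAt 𝓘(ℝ, EM) 𝓘(ℝ, EM).tangent
        (fun m => (⟨m, U m⟩ : TangentBundle 𝓘(ℝ, EM) M)) p :=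
    fun h => h.mdifferentiableAt (by simp)
  have key : ∀ {U W : ∀ p : M, TangentSpace 𝓘(ℝ, EM) p},
      ContMDiff 𝓘(ℝ, EM) 𝓘(ℝ, EM).tangent ∞
        (fun m => (⟨m, U m⟩ : TangentBundle 𝓘(ℝ, EM) M)) →
      ContMDiff 𝓘(ℝ, EM) 𝓘(ℝ, EM).tangent ∞
        (fun m => (⟨m, W m⟩ : TangentBundle 𝓘(ℝ, EM) M)) →
      mlieBracket 𝓘(ℝ, EM) U (mlieBracket 𝓘(ℝ, EM) W ((f : M → ℝ) • Z)) m =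
        mvfderiv 𝓘(ℝ, EM) (fun p => mvfderiv 𝓘(ℝ, EM) f p (W p)) m (U m) • Z m
        + mvfderiv 𝓘(ℝ, EM) f m (W m) • mlieBracket 𝓘(ℝ, EM) U Z m
        + (mvfderiv 𝓘(ℝ, EM) f m (U m) • mlieBracket 𝓘(ℝ, EM) W Z m
        + f m • mlieBracket 𝓘(ℝ, EM) U (mlieBracket 𝓘(ℝ, EM) W Z) m) := by
    intro U W hU hW
    have hg := contMDiff_mvfderiv_apply f hW
    have hgd : MDifferentiableAt 𝓘(ℝ, EM) 𝓘(ℝ, ℝ) (fun p => mvfderiv 𝓘(ℝ, EM) f p (W p)) m :=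
      (hg m).mdifferentiableAt (by simp)
    have e : mlieBracket 𝓘(ℝ, EM) W ((f : M → ℝ) • Z) =ᶠ[𝓝 m]
        (fun p => mvfderiv 𝓘(ℝ, EM) f p (W p)) • Z +
          (f : M → ℝ) • mlieBracket 𝓘(ℝ, EM) W Z := by
      filter_upwards [hZn] with p hp
      exact mlieBracket_smul_right (hf p) (hd hp)
    rw [EventuallyEq.mlieBracket_vectorField_eq (EventuallyEq.refl _ U) e,
      mlieBracket_add_right (hd ((hg m).smul_section hZ))
        (hd ((f.contMDiff m).smul_section (hb (hW m) hZ))),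
      mlieBracket_smul_right hgd (hd hZ), mlieBracket_smul_right (hf m) (hd (hb (hW m) hZ))]
  have jac := leibniz_identity_mlieBracket_apply (U := X) (V := Y) (W := (f : M → ℝ) • Z)
    ((hX m).of_le h2) ((hY m).of_le h2) (((f.contMDiff m).smul_section hZ).of_le h2)
  have jac' := leibniz_identity_mlieBracket_apply (U := X) (V := Y) (W := Z)
    ((hX m).of_le h2) ((hY m).of_le h2) (hZ.of_le h2)
  rw [key hX hY, key hY hX, mlieBracket_smul_right (hf m) (hd hZ), jac'] at jac
  refine smul_left_injective ℝ hZv ?_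
  simp only [sub_smul]
  rw [smul_add] at jac
  rw [← sub_eq_zero] at jac ⊢
  rw [← neg_eq_zero, ← jac]
  module
end

/-- The axioms of a (left) Leibniz algebra over `ℝ` for a bracket on a vector space. -/
structure IsLeibnizAlgebra {L : Type*} [AddCommGroup L] [Module ℝ L] (br : L → L → L) : Prop where
  add_left : ∀ X Y Z, br (X + Y) Z = br X Z + br Y Z
  smul_left : ∀ (c : ℝ) X Y, br (c • X) Y = c • br X Y
  add_right : ∀ X Y Z, br X (Y + Z) = br X Y + br X Z
  smul_right : ∀ (c : ℝ) X Y, br X (c • Y) = c • br X Y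
  leibniz : ∀ X Y Z, br X (br Y Z) = br (br X Y) Z + br Y (br X Z)

noncomputable section

variable {EM : Type*} [NormedAddCommGroup EM] [NormedSpace ℝ EM]
  {M : Type*} [TopologicalSpace M] [ChartedSpace EM M]
  {F : Type*} [NormedAddCommGroup F] [NormedSpace ℝ F]
  {V : M → Type*} [TopologicalSpace (TotalSpace F V)]
  [∀ m, AddCommGroup (V m)] [∀ m, Module ℝ (V m)] [∀ m, TopologicalSpace (V m)]
  [FiberBundle F V] [VectorBundle ℝ F V]

/-- Multiplication of a smooth section of the bundle by a smooth function. -/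
instance : SMul C^∞⟮𝓘(ℝ, EM), M; ℝ⟯ Cₛ^∞⟮𝓘(ℝ, EM); F, V⟯ :=
  ⟨fun f u => ⟨fun m => f m • u m, f.contMDiff.smul_section u.contMDiff⟩⟩

theorem smul_sec_apply (f : C^∞⟮𝓘(ℝ, EM), M; ℝ⟯) (u : Cₛ^∞⟮𝓘(ℝ, EM); F, V⟯) (m : M) :
    (f • u) m = f m • u m := rfl

variable (EM F V) in
/-- The fibre at `m` of the gauge Lie algebroid (bundle of covariant differential operators):
`ℝ`-linear operators `Γ(E) → E_m` together with an anchor `x ∈ T_m M` such that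
`𝔡(fu) = f(m) 𝔡(u) + x(f) u(m)`. The anchor is recorded as part of the data; it is determined by
the operator as soon as `E_m ≠ 0`. -/
def GaugeFiber (m : M) :
    Submodule ℝ ((Cₛ^∞⟮𝓘(ℝ, EM); F, V⟯ →ₗ[ℝ] V m) × TangentSpace 𝓘(ℝ, EM) m) where
  carrier := {δ | ∀ (f : C^∞⟮𝓘(ℝ, EM), M; ℝ⟯) (u : Cₛ^∞⟮𝓘(ℝ, EM); F, V⟯),
    δ.1 (f • u) = f m • δ.1 u + mvfderiv 𝓘(ℝ, EM) f m δ.2 • u m}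
  zero_mem' f u := by simp
  add_mem' {a b} ha hb f u := by
    simp only [Set.mem_ofPred_eq] at ha hb
    simp only [Prod.fst_add, Prod.snd_add, LinearMap.add_apply, map_add, ha, hb]
    module
  smul_mem' c a ha f u := by
    simp only [Set.mem_ofPred_eq] at ha
    simp only [Prod.smul_fst, Prod.smul_snd, LinearMap.smul_apply, map_smul, ha, smul_eq_mul]
    module

/-- The operator `Γ(E) → E_m` underlying an element of the gauge algebroid. -/
def gaugeOp {m : M} (δ : GaugeFiber EM F V m) : Cₛ^∞⟮𝓘(ℝ, EM); F, V⟯ →ₗ[ℝ] V m := δ.1.1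

/-- The anchor `α : 𝔇E → TM`. -/
def gaugeAnchor {m : M} (δ : GaugeFiber EM F V m) : TangentSpace 𝓘(ℝ, EM) m := δ.1.2

variable (EM F) in
/-- The embedding `gl(E_m) → (𝔇E)_m`, with `Φ` acting by `u ↦ Φ (u(m))` and zero anchor. -/
def gaugeOfEnd {m : M} (Φ : V m →ₗ[ℝ] V m) : GaugeFiber EM F V m :=
  ⟨({ toFun := fun u => Φ (u m)
      map_add' := fun u v => by simp
      map_smul' := fun c u => by simp }, 0),
    fun f u => by simp [smul_sec_apply]⟩

variable (EM F V) in
/-- The fibre at `m` of the (first) jet bundle `𝔍E`, as the standard `E`-dual of `𝔇E`: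
linear maps `ν : (𝔇E)_m → E_m` such that `ν(Φ) = Φ(ν(1))` for all `Φ ∈ gl(E_m)`. -/
def JetFiber (m : M) : Submodule ℝ (GaugeFiber EM F V m →ₗ[ℝ] V m) where
  carrier := {ν | ∀ Φ : V m →ₗ[ℝ] V m,
    ν (gaugeOfEnd EM F Φ) = Φ (ν (gaugeOfEnd EM F LinearMap.id))}
  zero_mem' Φ := by simp
  add_mem' {a b} ha hb Φ := by
    simp only [Set.mem_ofPred_eq] at ha hb
    simp only [LinearMap.add_apply, map_add, ha Φ, hb Φ]
  smul_mem' c a ha Φ := by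
    simp only [Set.mem_ofPred_eq] at ha
    simp only [LinearMap.smul_apply, map_smul, ha Φ]

variable [IsManifold 𝓘(ℝ, EM) ∞ M]

variable (EM F V) in
/-- `Γ(𝔇E)`: a section of the gauge algebroid is smooth when it maps smooth sections of `E` to
smooth sections of `E` and its anchor is a smooth vector field; so `Γ(𝔇E)` is the space of
covariant differential operators on `Γ(E)`. -/
def GaugeSec : Submodule ℝ (∀ m : M, GaugeFiber EM F V m) where
  carrier := {d |
    (∀ u : Cₛ^∞⟮𝓘(ℝ, EM); F, V⟯, ContMDiff 𝓘(ℝ, EM) (𝓘(ℝ, EM).prod 𝓘(ℝ, F)) ∞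
      (fun m => TotalSpace.mk' F m (gaugeOp (d m) u))) ∧
    ContMDiff 𝓘(ℝ, EM) 𝓘(ℝ, EM).tangent ∞
      (fun m => (⟨m, gaugeAnchor (d m)⟩ : TangentBundle 𝓘(ℝ, EM) M))}
  zero_mem' := ⟨fun _ => (0 : Cₛ^∞⟮𝓘(ℝ, EM); F, V⟯).contMDiff,
    (0 : Cₛ^∞⟮𝓘(ℝ, EM); EM, (TangentSpace 𝓘(ℝ, EM) : M → Type _)⟯).contMDiff⟩
  add_mem' ha hb := ⟨fun u => (ha.1 u).add_section (hb.1 u), ha.2.add_section hb.2⟩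
  smul_mem' _ _ ha := ⟨fun u => (ha.1 u).const_smul_section, ha.2.const_smul_section⟩

variable (EM F V) in
/-- `Γ(𝔍E)`: a section of `𝔍E ⊂ Hom(𝔇E, E)` is smooth when it maps smooth sections of `𝔇E` to
smooth sections of `E`. -/
def JetSec : Submodule ℝ (∀ m : M, JetFiber EM F V m) where
  carrier := {μ | ∀ d : GaugeSec EM F V, ContMDiff 𝓘(ℝ, EM) (𝓘(ℝ, EM).prod 𝓘(ℝ, F)) ∞
      (fun m => TotalSpace.mk' F m ((μ m).1 (d.1 m)))}
  zero_mem' _ := (0 : Cₛ^∞⟮𝓘(ℝ, EM); F, V⟯).contMDiff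
  add_mem' ha hb d := (ha d).add_section (hb d)
  smul_mem' _ _ ha d := (ha d).const_smul_section

/-- Multiplication of sections of `𝔇E` by smooth functions. -/
instance : SMul C^∞⟮𝓘(ℝ, EM), M; ℝ⟯ (GaugeSec EM F V) :=
  ⟨fun f d => ⟨fun m => f m • d.1 m,
    fun u => f.contMDiff.smul_section (d.2.1 u), f.contMDiff.smul_section d.2.2⟩⟩

/-- Multiplication of sections of `𝔍E` by smooth functions. -/
instance : SMul C^∞⟮𝓘(ℝ, EM), M; ℝ⟯ (JetSec EM F V) :=
  ⟨fun f μ => ⟨fun m => f m • μ.1 m, fun d => f.contMDiff.smul_section (μ.2 d)⟩⟩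

/-- The action of `Γ(𝔇E)` on `Γ(E)`. -/
def act (d : GaugeSec EM F V) (u : Cₛ^∞⟮𝓘(ℝ, EM); F, V⟯) : Cₛ^∞⟮𝓘(ℝ, EM); F, V⟯ :=
  ⟨fun m => gaugeOp (d.1 m) u, d.2.1 u⟩

/-- The derivative `α(d)(f)` of a smooth function along the anchor of `d ∈ Γ(𝔇E)`. -/
def anchorDeriv (d : GaugeSec EM F V) (f : C^∞⟮𝓘(ℝ, EM), M; ℝ⟯) : C^∞⟮𝓘(ℝ, EM), M; ℝ⟯ :=
  ⟨fun m => mvfderiv 𝓘(ℝ, EM) f m (gaugeAnchor (d.1 m)), contMDiff_mvfderiv_apply f d.2.2⟩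

theorem act_smul (d : GaugeSec EM F V) (f : C^∞⟮𝓘(ℝ, EM), M; ℝ⟯)
    (u : Cₛ^∞⟮𝓘(ℝ, EM); F, V⟯) : act d (f • u) = f • act d u + anchorDeriv d f • u := by
  ext m
  exact (d.1 m).2 f u

/-- The bracket `[d, r]_𝔇` on `Γ(𝔇E)`: the commutator of the operators on `Γ(E)`, whose anchor is
the Lie bracket of the anchors. -/
def gaugeBracket [FiniteDimensional ℝ EM] (d r : GaugeSec EM F V) : GaugeSec EM F V :=
  ⟨fun m => ⟨(gaugeOp (d.1 m) ∘ₗ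
        { toFun := act r
          map_add' := fun u v => by ext p; exact map_add (gaugeOp (r.1 p)) u v
          map_smul' := fun c u => by ext p; exact map_smul (gaugeOp (r.1 p)) c u } -
      gaugeOp (r.1 m) ∘ₗ
        { toFun := act d
          map_add' := fun u v => by ext p; exact map_add (gaugeOp (d.1 p)) u v
          map_smul' := fun c u => by ext p; exact map_smul (gaugeOp (d.1 p)) c u },
      mlieBracket 𝓘(ℝ, EM) (fun p => gaugeAnchor (d.1 p)) (fun p => gaugeAnchor (r.1 p)) m), by
    intro f u
    have h1 : gaugeOp (d.1 m) (f • act r u) = _ := (d.1 m).2 f (act r u)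
    have h2 : gaugeOp (d.1 m) (anchorDeriv r f • u) = _ := (d.1 m).2 (anchorDeriv r f) u
    have h3 : gaugeOp (r.1 m) (f • act d u) = _ := (r.1 m).2 f (act d u)
    have h4 : gaugeOp (r.1 m) (anchorDeriv d f • u) = _ := (r.1 m).2 (anchorDeriv d f) u
    simp only [LinearMap.sub_apply, LinearMap.comp_apply, LinearMap.coe_mk, AddHom.coe_mk,
      act_smul, map_add, mvfderiv_mlieBracket f d.2.2 r.2.2 m, h1, h2, h3, h4]
    change _ = f m • (gaugeOp (d.1 m) (act r u) - gaugeOp (r.1 m) (act d u)) +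
      (mvfderiv 𝓘(ℝ, EM) (anchorDeriv r f) m (gaugeAnchor (d.1 m)) -
        mvfderiv 𝓘(ℝ, EM) (anchorDeriv d f) m (gaugeAnchor (r.1 m))) • u m
    change (f m • gaugeOp (d.1 m) (act r u) +
        mvfderiv 𝓘(ℝ, EM) f m (gaugeAnchor (d.1 m)) • gaugeOp (r.1 m) u +
        (mvfderiv 𝓘(ℝ, EM) f m (gaugeAnchor (r.1 m)) • gaugeOp (d.1 m) u +
          mvfderiv 𝓘(ℝ, EM) (anchorDeriv r f) m (gaugeAnchor (d.1 m)) • u m)) -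
      (f m • gaugeOp (r.1 m) (act d u) +
        mvfderiv 𝓘(ℝ, EM) f m (gaugeAnchor (r.1 m)) • gaugeOp (d.1 m) u +
        (mvfderiv 𝓘(ℝ, EM) f m (gaugeAnchor (d.1 m)) • gaugeOp (r.1 m) u +
          mvfderiv 𝓘(ℝ, EM) (anchorDeriv d f) m (gaugeAnchor (r.1 m)) • u m)) = _
    module⟩,
  fun u => (act d (act r u) - act r (act d u)).contMDiff, by
    have := FiniteDimensional.complete ℝ EM
    have : IsManifold 𝓘(ℝ, EM) (((⊤ : ℕ∞) : ℕ∞ω) + 1) M := by simpa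
    have : IsManifold 𝓘(ℝ, EM) (minSmoothness ℝ 2) M := IsManifold.of_le (n := ∞) (by
      rw [minSmoothness_of_isRCLikeNormedField]
      exact WithTop.coe_le_coe.2 (le_top : (2 : ℕ∞) ≤ ⊤))
    exact ContDiff.mlieBracket_vectorField (m := ⊤) (n := ⊤) d.2.2 r.2.2 (by
      rw [minSmoothness_of_isRCLikeNormedField]; simp)⟩

/-- The `E`-valued pairing `⟨μ, d⟩_E` of sections. -/
def pairing (μ : JetSec EM F V) (d : GaugeSec EM F V) : Cₛ^∞⟮𝓘(ℝ, EM); F, V⟯ :=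
  ⟨fun m => (μ.1 m).1 (d.1 m), μ.2 d⟩

/-- The differential `𝕕 : Γ(E) → Γ(𝔍E)`, `(𝕕u)(𝔡) = 𝔡(u)`, that is, `𝕕u = [u]` is the jet
prolongation of `u`. -/
def jetD (u : Cₛ^∞⟮𝓘(ℝ, EM); F, V⟯) : JetSec EM F V :=
  ⟨fun _ => ⟨{ toFun := fun δ => gaugeOp δ u
               map_add' := fun _ _ => rfl
               map_smul' := fun _ _ => rfl }, fun _ => rfl⟩,
    fun d => d.2.1 u⟩

/-- The Leibniz rule characterizing the Lie derivative `ν = 𝔏_d μ`: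
`⟨ν, r⟩ = d⟨μ, r⟩ - ⟨μ, [d, r]⟩` for all `r ∈ Γ(𝔇E)`. -/
def IsLieDerivative [FiniteDimensional ℝ EM] (d : GaugeSec EM F V) (μ ν : JetSec EM F V) : Prop :=
  ∀ r : GaugeSec EM F V, pairing ν r = act d (pairing μ r) - pairing μ (gaugeBracket d r)

open Classical in
/-- The Lie derivative `𝔏_d μ ∈ Γ(𝔍E)`: the section characterized by `IsLieDerivative d μ`.
It always exists and is unique on a vector bundle of finite rank over a manifold; the theorem
asserts this together with the properties of the bracket. -/
def lieDerivative [FiniteDimensional ℝ EM] (d : GaugeSec EM F V) (μ : JetSec EM F V) : JetSec EM F V :=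
  if h : ∃ ν, IsLieDerivative d μ ν then h.choose else 0

variable (EM F V) in
/-- `Γ(𝓔)` for `𝓔 = 𝔇E ⊕ 𝔍E`. -/
abbrev OmniSec := GaugeSec EM F V × JetSec EM F V

/-- The projection `ρ : Γ(𝓔) → Γ(𝔇E)`. -/
def rho (X : OmniSec EM F V) : GaugeSec EM F V := X.1

/-- The symmetric `E`-valued pairing `(d + μ, r + ν)_E = ½ (⟨d, ν⟩_E + ⟨r, μ⟩_E)`. -/
def omniPairing (X Y : OmniSec EM F V) : Cₛ^∞⟮𝓘(ℝ, EM); F, V⟯ :=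
  (1 / 2 : ℝ) • (pairing Y.2 X.1 + pairing X.2 Y.1)

/-- The Dorfman bracket `{d + μ, r + ν} = [d, r]_𝔇 + 𝔏_d ν - 𝔏_r μ + 𝕕⟨μ, r⟩_E`. -/
def dorfman [FiniteDimensional ℝ EM] (X Y : OmniSec EM F V) : OmniSec EM F V :=
  (gaugeBracket X.1 Y.1,
    lieDerivative X.1 Y.2 - lieDerivative Y.1 X.2 + jetD (pairing X.2 Y.1))

end

end OmniLie

namespace OmniLie

noncomputable section

variable {EM : Type*} [NormedAddCommGroup EM] [NormedSpace ℝ EM]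
  {M : Type*} [TopologicalSpace M] [ChartedSpace EM M]
  {F : Type*} [NormedAddCommGroup F] [NormedSpace ℝ F]
  {V : M → Type*} [TopologicalSpace (TotalSpace F V)]
  [∀ m, AddCommGroup (V m)] [∀ m, Module ℝ (V m)] [∀ m, TopologicalSpace (V m)]
  [FiberBundle F V] [VectorBundle ℝ F V]

/-! The bracket identities are formal once two facts about sections are known. A section of the jet
bundle is determined by its pairings with global sections of the gauge algebroid (`jetSec_ext`), and
the right-hand side defining the Lie derivative really comes from such a section
(`exists_isLieDerivative`).

Both facts rest on partial frames that are global. A local frame multiplied by a bump function gives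
finitely many global sections that expand every vector up to a smooth factor equal to 1 at the
chosen point. Such frames of `E` and of `TM` combine into one for the gauge algebroid
(`exists_gaugeSec_frame`): a covariant differential operator is determined by its anchor and its
values on a frame of `E`. Hence fibre elements extend to global sections, and a `C^∞(M)`-linear map
from sections of the gauge algebroid to sections of `E` acts fibre by fibre
(`exists_fiberwise_of_smul`).

The Dorfman identities are then tested against an arbitrary section `s` of the gauge algebroid. By
`pairing_dorfman` each becomes an identity between sections of `E` that follows from additivity, the
Leibniz rule and, for the Leibniz identity, the Jacobi identity. -/

/-! ### Cutoff frames of a vector bundle -/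

variable (EM F V) in
/-- A finite family of global smooth sections `s i` of a vector bundle with smooth coordinate
functionals `coord i`, such that `∑ i, coord i v • s i = cut • v` for a smooth function `cut`
with value `1` at `m`. -/
structure CutoffFrame (m : M) where
  rank : ℕ
  sec : Fin rank → Cₛ^∞⟮𝓘(ℝ, EM); F, V⟯
  coord : Fin rank → ∀ p : M, V p →ₗ[ℝ] ℝ
  contMDiff_coord : ∀ i (u : Cₛ^∞⟮𝓘(ℝ, EM); F, V⟯),
    ContMDiff 𝓘(ℝ, EM) 𝓘(ℝ, ℝ) ∞ (fun p => coord i p (u p))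
  cut : C^∞⟮𝓘(ℝ, EM), M; ℝ⟯
  cut_self : cut m = 1
  sum_coord_smul_sec : ∀ p (v : V p), ∑ i, coord i p v • sec i p = cut p • v

/-- Every point of a Hausdorff manifold admits a cutoff frame, obtained from a local frame and a
bump function. -/
theorem nonempty_cutoffFrame [FiniteDimensional ℝ EM] [T2Space M] [IsManifold 𝓘(ℝ, EM) ∞ M]
    [FiniteDimensional ℝ F] [ContMDiffVectorBundle ∞ F V 𝓘(ℝ, EM)] (m : M) :
    Nonempty (CutoffFrame EM F V m) := by
  have : ContMDiffVectorBundle 1 F V 𝓘(ℝ, EM) := ContMDiffVectorBundle.of_le (n := ∞) (by simp)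
  let e := trivializationAt F V m
  let b := Module.finBasis ℝ F
  -- The frame sections and the coordinate functionals must both be extended by zero outside the
  -- trivializing set. Each is multiplied by the same bump `φ`, so the cutoff of the frame is `φ ^
  -- 2`.
  obtain ⟨φ, -, hφ⟩ := (SmoothBumpFunction.nhds_basis_tsupport (I := 𝓘(ℝ, EM)) m).mem_iff.1
    (e.open_baseSet.mem_nhds (FiberBundle.mem_baseSet_trivializationAt' m))
  refine ⟨⟨_, fun i => ⟨(φ : M → ℝ) • e.localFrame b i, ?_⟩,
    fun i p => φ p • e.localFrameCoeff 𝓘(ℝ, EM) b i p, fun i u => ?_,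
    ⟨fun p => φ p * φ p, φ.contMDiff.mul φ.contMDiff⟩, ?_, fun p v => ?_⟩⟩
  · exact ContMDiffOn.smul_section_of_tsupport φ.contMDiff.contMDiffOn e.open_baseSet hφ
      (e.contMDiffOn_localFrame_baseSet ∞ b i)
  · refine contMDiff_of_tsupport fun p hp => ?_
    have hp' : p ∈ tsupport φ := by
      refine closure_mono ?_ hp
      intro q hq hq'
      exact hq (by simp [hq'])
    exact (φ.contMDiff p).mul
      (contMDiffAt_localFrameCoeff (I := 𝓘(ℝ, EM)) (e := e) b (hφ hp') (u.contMDiff p) i)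
  · change φ m * φ m = 1
    simp
  · by_cases hp : p ∈ e.baseSet
    · classical
      -- The expansion lemma concerns sections, so the vector `v` is made the value at `p` of a
      -- section that vanishes elsewhere; no smoothness is required.
      have h := e.eq_sum_localFrameCoeff_smul (I := 𝓘(ℝ, EM)) (b := b)
        (s := Function.update (0 : ∀ p, V p) p v) hp
      simp only [Function.update_self] at h
      change ∑ i, (φ p • e.localFrameCoeff 𝓘(ℝ, EM) b i p) v • (φ p • e.localFrame b i p) =
        (φ p * φ p) • v
      conv_rhs => rw [h]
      rw [Finset.smul_sum]
      refine Finset.sum_congr rfl fun i _ => ?_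
      simp only [LinearMap.smul_apply, smul_eq_mul, smul_smul]
      ring_nf
    · have h0 : φ p = 0 := image_eq_zero_of_notMem_tsupport fun h => hp (hφ h)
      change ∑ i, (φ p • e.localFrameCoeff 𝓘(ℝ, EM) b i p) v • (φ p • e.localFrame b i p) =
        (φ p * φ p) • v
      simp [h0]

theorem mvfderiv_map_add (f g : C^∞⟮𝓘(ℝ, EM), M; ℝ⟯) (p : M) (x : TangentSpace 𝓘(ℝ, EM) p) :
    mvfderiv 𝓘(ℝ, EM) (f + g) p x = mvfderiv 𝓘(ℝ, EM) f p x + mvfderiv 𝓘(ℝ, EM) g p x := by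
  simp only [ContMDiffMap.coe_add]
  rw [mvfderiv_add f.mdifferentiableAt g.mdifferentiableAt]
  rfl

theorem mvfderiv_map_mul (f g : C^∞⟮𝓘(ℝ, EM), M; ℝ⟯) (p : M) (x : TangentSpace 𝓘(ℝ, EM) p) :
    mvfderiv 𝓘(ℝ, EM) (f * g) p x =
      f p * mvfderiv 𝓘(ℝ, EM) g p x + g p * mvfderiv 𝓘(ℝ, EM) f p x := by
  simp only [ContMDiffMap.coe_mul]
  rw [mvfderiv_mul f.mdifferentiableAt g.mdifferentiableAt]
  rfl

theorem mvfderiv_map_smul (c : ℝ) (f : C^∞⟮𝓘(ℝ, EM), M; ℝ⟯) (p : M)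
    (x : TangentSpace 𝓘(ℝ, EM) p) :
    mvfderiv 𝓘(ℝ, EM) (c • f) p x = c * mvfderiv 𝓘(ℝ, EM) f p x := by
  -- Homogeneity is the product rule with a constant function as one factor.
  let k : C^∞⟮𝓘(ℝ, EM), M; ℝ⟯ := ⟨fun _ => c, contMDiff_const⟩
  have h := mvfderiv_map_mul k f p x
  have h0 : mvfderiv 𝓘(ℝ, EM) k p x = 0 := by
    change mvfderiv 𝓘(ℝ, EM) (fun _ : M => c) p x = 0
    rw [mvfderiv_const]; rfl
  rw [h0, mul_zero, add_zero] at h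
  exact h

theorem sum_smul_sec_apply {κ : Type*} [Fintype κ] (f : κ → C^∞⟮𝓘(ℝ, EM), M; ℝ⟯)
    (s : κ → Cₛ^∞⟮𝓘(ℝ, EM); F, V⟯) (p : M) :
    (∑ j, f j • s j) p = ∑ j, f j p • s j p := by
  have h := congrFun (map_sum (ContMDiffSection.coeAddHom 𝓘(ℝ, EM) F ∞ V)
    (fun j => f j • s j) Finset.univ) p
  rw [Finset.sum_apply] at h
  exact h

namespace CutoffFrame

variable {m : M} (S : CutoffFrame EM F V m)

/-- The coordinate functions of a section in a cutoff frame. -/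
def coeff (i : Fin S.rank) (u : Cₛ^∞⟮𝓘(ℝ, EM); F, V⟯) : C^∞⟮𝓘(ℝ, EM), M; ℝ⟯ :=
  ⟨fun p => S.coord i p (u p), S.contMDiff_coord i u⟩

theorem coeff_apply (i : Fin S.rank) (u : Cₛ^∞⟮𝓘(ℝ, EM); F, V⟯) (p : M) :
    S.coeff i u p = S.coord i p (u p) := rfl

theorem coeff_add (i : Fin S.rank) (u v : Cₛ^∞⟮𝓘(ℝ, EM); F, V⟯) :
    S.coeff i (u + v) = S.coeff i u + S.coeff i v := by
  ext p; exact map_add (S.coord i p) _ _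

theorem coeff_const_smul (i : Fin S.rank) (c : ℝ) (u : Cₛ^∞⟮𝓘(ℝ, EM); F, V⟯) :
    S.coeff i (c • u) = c • S.coeff i u := by
  ext p; exact map_smul (S.coord i p) _ _

theorem coeff_smul (i : Fin S.rank) (f : C^∞⟮𝓘(ℝ, EM), M; ℝ⟯) (u : Cₛ^∞⟮𝓘(ℝ, EM); F, V⟯) :
    S.coeff i (f • u) = f * S.coeff i u := by
  ext p; exact map_smul (S.coord i p) _ _

theorem sum_coeff_smul_sec (u : Cₛ^∞⟮𝓘(ℝ, EM); F, V⟯) :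
    ∑ i, S.coeff i u • S.sec i = S.cut • u := by
  ext p
  rw [smul_sec_apply, ← S.sum_coord_smul_sec]
  exact sum_smul_sec_apply _ _ p

/-- A fibre element of the gauge algebroid is determined by its anchor and by its values on the
sections of a cutoff frame. -/
theorem cut_smul_gaugeOp {p : M} (δ : GaugeFiber EM F V p) (u : Cₛ^∞⟮𝓘(ℝ, EM); F, V⟯) :
    S.cut p • gaugeOp δ u =
      ∑ i, (S.coord i p (u p) • gaugeOp δ (S.sec i) +
        mvfderiv 𝓘(ℝ, EM) (S.coeff i u) p (gaugeAnchor δ) • S.sec i p) -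
      mvfderiv 𝓘(ℝ, EM) S.cut p (gaugeAnchor δ) • u p := by
  have h : ∀ (f : C^∞⟮𝓘(ℝ, EM), M; ℝ⟯) (u : Cₛ^∞⟮𝓘(ℝ, EM); F, V⟯), gaugeOp δ (f • u) =
    f p • gaugeOp δ u + mvfderiv 𝓘(ℝ, EM) f p (gaugeAnchor δ) • u p := δ.2
  -- Two evaluations of `δ` on `cut • u` are compared: by the Leibniz rule directly, and term by
  -- term after expanding `cut • u` in the frame.
  rw [eq_sub_iff_add_eq, ← h, ← S.sum_coeff_smul_sec, map_sum]
  exact Finset.sum_congr rfl fun i _ => h _ _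

variable [IsManifold 𝓘(ℝ, EM) ∞ M]

/-- The section `u ↦ coord i u • s` of `gl(E) ⊂ 𝔇E`. -/
def endSec (i : Fin S.rank) (s : Cₛ^∞⟮𝓘(ℝ, EM); F, V⟯) : GaugeSec EM F V :=
  ⟨fun p => gaugeOfEnd EM F ((S.coord i p).smulRight (s p)),
    fun u => (S.coeff i u • s).contMDiff, (0 : GaugeSec EM F V).2.2⟩

/-- The covariant differential operator `u ↦ ∑ i, Y(coord i u) • s i - Y(cut) u`, with anchor
`cut • Y`. -/
def derivSec (Y : Cₛ^∞⟮𝓘(ℝ, EM); EM, (TangentSpace 𝓘(ℝ, EM) : M → Type _)⟯) :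
    GaugeSec EM F V :=
  ⟨fun p => ⟨({
      toFun := fun u => ∑ i, mvfderiv 𝓘(ℝ, EM) (S.coeff i u) p (Y p) • S.sec i p -
        mvfderiv 𝓘(ℝ, EM) S.cut p (Y p) • u p
      map_add' := fun u v => by
        simp only [coeff_add, mvfderiv_map_add, add_smul, Finset.sum_add_distrib,
          ContMDiffSection.coe_add, Pi.add_apply, smul_add]
        abel
      map_smul' := fun c u => by
        simp only [coeff_const_smul, mvfderiv_map_smul, mul_smul, ← Finset.smul_sum,
          ContMDiffSection.coe_smul, Pi.smul_apply, smul_sub, RingHom.id_apply]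
        rw [smul_comm c] }, S.cut p • Y p), fun f u => by
      change ∑ i, mvfderiv 𝓘(ℝ, EM) (S.coeff i (f • u)) p (Y p) • S.sec i p -
          mvfderiv 𝓘(ℝ, EM) S.cut p (Y p) • (f p • u p) =
        f p • (∑ i, mvfderiv 𝓘(ℝ, EM) (S.coeff i u) p (Y p) • S.sec i p -
          mvfderiv 𝓘(ℝ, EM) S.cut p (Y p) • u p) +
          mvfderiv 𝓘(ℝ, EM) f p (S.cut p • Y p) • u p
      -- When `Y` differentiates `f`, the coordinates of `u` are left over and reassemble to `cut •
      -- u`; this is why the anchor is `cut • Y` rather than `Y`.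
      have h : mvfderiv 𝓘(ℝ, EM) f p (S.cut p • Y p) • u p =
          mvfderiv 𝓘(ℝ, EM) f p (Y p) • ∑ i, S.coord i p (u p) • S.sec i p := by
        rw [S.sum_coord_smul_sec, map_smul, smul_smul, smul_eq_mul, mul_comm]
      rw [h]
      simp only [coeff_smul, mvfderiv_map_mul, add_smul, Finset.sum_add_distrib, mul_smul,
          ← Finset.smul_sum, smul_sub, coeff_apply]
      have h2 : ∑ i, S.coord i p (u p) • mvfderiv 𝓘(ℝ, EM) f p (Y p) • S.sec i p =
          mvfderiv 𝓘(ℝ, EM) f p (Y p) • ∑ i, S.coord i p (u p) • S.sec i p := by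
        rw [Finset.smul_sum]
        exact Finset.sum_congr rfl fun i _ => smul_comm _ _ _
      rw [h2, smul_comm (f p) (mvfderiv 𝓘(ℝ, EM) S.cut p (Y p))]
      abel⟩,
    fun u => by
      have h : ContMDiff 𝓘(ℝ, EM) (𝓘(ℝ, EM).prod 𝓘(ℝ, F)) ∞ (fun p => TotalSpace.mk' F p
          (∑ i, mvfderiv 𝓘(ℝ, EM) (S.coeff i u) p (Y p) • S.sec i p)) :=
        ContMDiff.sum_section fun i _ =>
          (contMDiff_mvfderiv_apply (S.coeff i u) Y.contMDiff).smul_section (S.sec i).contMDiff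
      exact h.sub_section ((contMDiff_mvfderiv_apply S.cut Y.contMDiff).smul_section u.contMDiff),
    S.cut.contMDiff.smul_section Y.contMDiff⟩

end CutoffFrame

/-! ### Fibres of the gauge algebroid -/

/-- The anchor has to be compared separately, since over a zero fibre of `E` the operator carries no
information about it. -/
theorem gaugeFiber_ext {p : M} {δ ε : GaugeFiber EM F V p}
    (hop : ∀ u, gaugeOp δ u = gaugeOp ε u) (ha : gaugeAnchor δ = gaugeAnchor ε) : δ = ε :=
  Subtype.ext (Prod.ext (LinearMap.ext hop) ha)

/-- The operator `Γ(E) → E_p` as a linear function of the fibre element. -/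
def gaugeOpHom (p : M) (u : Cₛ^∞⟮𝓘(ℝ, EM); F, V⟯) : GaugeFiber EM F V p →ₗ[ℝ] V p where
  toFun δ := gaugeOp δ u
  map_add' _ _ := rfl
  map_smul' _ _ := rfl

theorem gaugeOpHom_apply {p : M} (u : Cₛ^∞⟮𝓘(ℝ, EM); F, V⟯) (δ : GaugeFiber EM F V p) :
    gaugeOpHom p u δ = gaugeOp δ u := rfl

variable (EM F V) in
/-- The anchor as a linear map on a fibre. -/
def gaugeAnchorHom (p : M) : GaugeFiber EM F V p →ₗ[ℝ] TangentSpace 𝓘(ℝ, EM) p where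
  toFun δ := gaugeAnchor δ
  map_add' _ _ := rfl
  map_smul' _ _ := rfl

theorem gaugeAnchorHom_apply {p : M} (δ : GaugeFiber EM F V p) :
    gaugeAnchorHom EM F V p δ = gaugeAnchor δ := rfl

theorem sum_smul_gaugeSec_apply [IsManifold 𝓘(ℝ, EM) ∞ M] {κ : Type*} [Fintype κ]
    (f : κ → C^∞⟮𝓘(ℝ, EM), M; ℝ⟯) (R : κ → GaugeSec EM F V) (p : M) :
    (∑ j, f j • R j).1 p = ∑ j, f j p • (R j).1 p := by
  rw [Submodule.coe_sum, Finset.sum_apply]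
  rfl

/-! ### Global sections of the gauge algebroid and fibrewise linearity -/

section Frames

variable [FiniteDimensional ℝ EM] [T2Space M] [IsManifold 𝓘(ℝ, EM) ∞ M]
  [FiniteDimensional ℝ F] [ContMDiffVectorBundle ∞ F V 𝓘(ℝ, EM)]

/-- The gauge algebroid has, around each point, a finite family of global sections spanning it,
with smooth coordinate functionals. -/
theorem exists_gaugeSec_frame (m : M) :
    ∃ (κ : Type) (_ : Fintype κ) (R : κ → GaugeSec EM F V)
      (c : κ → ∀ p : M, GaugeFiber EM F V p →ₗ[ℝ] ℝ) (θ : C^∞⟮𝓘(ℝ, EM), M; ℝ⟯),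
      θ m = 1 ∧
      (∀ j (r : GaugeSec EM F V), ContMDiff 𝓘(ℝ, EM) 𝓘(ℝ, ℝ) ∞ (fun p => c j p (r.1 p))) ∧
      ∀ p (δ : GaugeFiber EM F V p), ∑ j, c j p δ • (R j).1 p = θ p • δ := by
  obtain ⟨S⟩ := nonempty_cutoffFrame (EM := EM) (F := F) (V := V) m
  obtain ⟨T⟩ := nonempty_cutoffFrame (EM := EM) (F := EM)
    (V := (TangentSpace 𝓘(ℝ, EM) : M → Type _)) m
  -- The pairs index elementary endomorphisms, with the matrix entries of `δ` on the frame of `E` as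
  -- coefficients; the remaining indices carry the anchor of `δ`. The factors `T.cut` and `S.cut` in
  -- the coefficients bring the two parts to the common factor `T.cut * S.cut`, and
  -- `cut_smul_gaugeOp` supplies the second `S.cut`.
  refine ⟨(Fin S.rank × Fin S.rank) ⊕ Fin T.rank, inferInstance,
    Sum.elim (fun ij => S.endSec ij.1 (S.sec ij.2)) (fun k => S.derivSec (T.sec k)),
    Sum.elim (fun ij p => T.cut p • (S.coord ij.2 p ∘ₗ gaugeOpHom p (S.sec ij.1)))
      (fun k p => S.cut p • (T.coord k p ∘ₗ gaugeAnchorHom EM F V p)),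
    T.cut * (S.cut * S.cut), ?_, ?_, ?_⟩
  · change T.cut m * (S.cut m * S.cut m) = 1
    simp [S.cut_self, T.cut_self]
  · rintro (⟨i, j⟩ | k) r
    · exact T.cut.contMDiff.mul (S.contMDiff_coord j (act r (S.sec i)))
    · exact S.cut.contMDiff.mul (T.contMDiff_coord k ⟨_, r.2.2⟩)
  · intro p δ
    have hcut : (T.cut * (S.cut * S.cut)) p = T.cut p * (S.cut p * S.cut p) := rfl
    rw [Fintype.sum_sum_type, Fintype.sum_prod_type]
    refine gaugeFiber_ext (fun u => ?_) ?_
    · rw [← gaugeOpHom_apply, ← gaugeOpHom_apply, map_smul, hcut, map_add, map_sum, map_sum,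
        gaugeOpHom_apply u δ]
      simp only [map_sum, map_smul]
      change ∑ i, ∑ j, (T.cut p * S.coord j p (gaugeOp δ (S.sec i))) •
          (S.coord i p (u p) • S.sec j p) +
        ∑ k, (S.cut p * T.coord k p (gaugeAnchor δ)) •
          (∑ i, mvfderiv 𝓘(ℝ, EM) (S.coeff i u) p (T.sec k p) • S.sec i p -
            mvfderiv 𝓘(ℝ, EM) S.cut p (T.sec k p) • u p) = _
      have h1 : ∀ i, ∑ j, (T.cut p * S.coord j p (gaugeOp δ (S.sec i))) •
          (S.coord i p (u p) • S.sec j p) =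
          (T.cut p * S.cut p) • (S.coord i p (u p) • gaugeOp δ (S.sec i)) := by
        intro i
        have h := S.sum_coord_smul_sec p (gaugeOp δ (S.sec i))
        rw [mul_smul, smul_comm (S.cut p), ← h, Finset.smul_sum, Finset.smul_sum]
        exact Finset.sum_congr rfl fun j _ => by module
      have h2 : ∀ f : C^∞⟮𝓘(ℝ, EM), M; ℝ⟯, T.cut p * mvfderiv 𝓘(ℝ, EM) f p (gaugeAnchor δ) =
          ∑ k, T.coord k p (gaugeAnchor δ) * mvfderiv 𝓘(ℝ, EM) f p (T.sec k p) := by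
        intro f
        have h := congrArg (mvfderiv 𝓘(ℝ, EM) f p) (T.sum_coord_smul_sec p (gaugeAnchor δ))
        rw [map_sum, map_smul] at h
        simpa only [map_smul, smul_eq_mul] using h.symm
      have h3 : ∑ k, (S.cut p * T.coord k p (gaugeAnchor δ)) •
          (∑ i, mvfderiv 𝓘(ℝ, EM) (S.coeff i u) p (T.sec k p) • S.sec i p -
            mvfderiv 𝓘(ℝ, EM) S.cut p (T.sec k p) • u p) =
          (T.cut p * S.cut p) • (∑ i, mvfderiv 𝓘(ℝ, EM) (S.coeff i u) p (gaugeAnchor δ) •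
            S.sec i p - mvfderiv 𝓘(ℝ, EM) S.cut p (gaugeAnchor δ) • u p) := by
        simp only [smul_sub, Finset.sum_sub_distrib, Finset.smul_sum, smul_smul]
        congr 1
        · rw [Finset.sum_comm]
          refine Finset.sum_congr rfl fun i _ => ?_
          rw [← Finset.sum_smul, mul_comm (T.cut p), mul_assoc, h2, Finset.mul_sum]
          simp only [mul_assoc]
        · rw [← Finset.sum_smul, mul_comm (T.cut p), mul_assoc, h2, Finset.mul_sum]
          simp only [mul_assoc]
      rw [h3, Finset.sum_congr rfl fun i _ => h1 i, ← Finset.smul_sum, ← smul_add,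
        ← mul_assoc, mul_smul (T.cut p * S.cut p), S.cut_smul_gaugeOp, Finset.sum_add_distrib, add_sub_assoc]
    · rw [← gaugeAnchorHom_apply, ← gaugeAnchorHom_apply, map_smul, hcut, map_add, map_sum, map_sum,
        gaugeAnchorHom_apply δ]
      simp only [map_sum, map_smul]
      change ∑ i, ∑ j, (T.cut p * S.coord j p (gaugeOp δ (S.sec i))) •
          (0 : TangentSpace 𝓘(ℝ, EM) p) +
        ∑ k, (S.cut p * T.coord k p (gaugeAnchor δ)) • (S.cut p • T.sec k p) = _
      rw [mul_comm, mul_smul, ← T.sum_coord_smul_sec, Finset.smul_sum]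
      simp only [smul_zero, Finset.sum_const_zero, zero_add]
      exact Finset.sum_congr rfl fun k _ => by module

/-- Every fibre element of the gauge algebroid extends to a global section. -/
theorem exists_gaugeSec_eq {m : M} (δ : GaugeFiber EM F V m) :
    ∃ r : GaugeSec EM F V, r.1 m = δ := by
  obtain ⟨κ, _, R, c, θ, hθ, -, h⟩ := exists_gaugeSec_frame (EM := EM) (F := F) (V := V) m
  refine ⟨∑ j, c j m δ • R j, ?_⟩
  rw [Submodule.coe_sum, Finset.sum_apply]
  refine (h m δ).trans ?_
  rw [hθ, one_smul]

/-- Two sections of the jet bundle with the same pairings agree. -/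
theorem jetSec_ext {μ ν : JetSec EM F V} (h : ∀ r, pairing μ r = pairing ν r) : μ = ν := by
  refine Subtype.ext (funext fun m => Subtype.ext (LinearMap.ext fun δ => ?_))
  obtain ⟨r, rfl⟩ := exists_gaugeSec_eq δ
  exact congrArg (fun u : Cₛ^∞⟮𝓘(ℝ, EM); F, V⟯ => u m) (h r)

/-- A `C^∞(M)`-linear map `Γ(𝔇E) → Γ(E)` is given by a family of linear maps of the fibres. -/
theorem exists_fiberwise_of_smul (L : GaugeSec EM F V →+ Cₛ^∞⟮𝓘(ℝ, EM); F, V⟯)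
    (hL : ∀ (f : C^∞⟮𝓘(ℝ, EM), M; ℝ⟯) r, L (f • r) = f • L r) :
    ∃ ν : ∀ m, GaugeFiber EM F V m →ₗ[ℝ] V m, ∀ r m, L r m = ν m (r.1 m) := by
  choose κ hκ R c θ hθ hc h using exists_gaugeSec_frame (EM := EM) (F := F) (V := V)
  -- Since `θ m` is 1 at `m`, the value of `L r` there equals that of `L (θ m • r)`. Expanding `θ m
  -- • r` in the frame at `m` and using linearity leaves only the coefficients of `r` at `m`.
  refine ⟨fun m => ∑ j, (c m j m).smulRight (L (R m j) m), fun r m => ?_⟩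
  let g : κ m → C^∞⟮𝓘(ℝ, EM), M; ℝ⟯ := fun j => ⟨_, hc m j r⟩
  have h1 : θ m • r = ∑ j, g j • R m j := by
    refine Subtype.ext (funext fun p => ?_)
    rw [sum_smul_gaugeSec_apply]
    exact (h m p (r.1 p)).symm
  have h2 : (θ m • L r) m = L r m := by rw [smul_sec_apply, hθ, one_smul]
  rw [← h2, ← hL, h1, map_sum, Finset.sum_congr rfl fun j _ => hL _ _, sum_smul_sec_apply,
    LinearMap.sum_apply]
  rfl

/-- The fibre elements with zero anchor are the endomorphisms of the fibre of `E`. -/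
theorem exists_eq_gaugeOfEnd {m : M} {δ : GaugeFiber EM F V m} (hδ : gaugeAnchor δ = 0) :
    ∃ Φ : V m →ₗ[ℝ] V m, δ = gaugeOfEnd EM F Φ := by
  obtain ⟨S⟩ := nonempty_cutoffFrame (EM := EM) (F := F) (V := V) m
  refine ⟨∑ i, (S.coord i m).smulRight (gaugeOp δ (S.sec i)), gaugeFiber_ext (fun u => ?_) hδ⟩
  -- With zero anchor the derivative terms vanish, and the cutoff is 1 at `m`, so only values of `u`
  -- at `m` remain.
  have h := S.cut_smul_gaugeOp δ u
  rw [hδ, S.cut_self, one_smul] at h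
  rw [h]
  change _ = (∑ i, (S.coord i m).smulRight (gaugeOp δ (S.sec i))) (u m)
  simp [LinearMap.sum_apply]

/-- Every endomorphism of a fibre of `E` extends to a section of `𝔇E` with zero anchor. -/
theorem exists_gaugeSec_eq_gaugeOfEnd {m : M} (Φ : V m →ₗ[ℝ] V m) :
    ∃ r : GaugeSec EM F V, r.1 m = gaugeOfEnd EM F Φ ∧ ∀ p, gaugeAnchor (r.1 p) = 0 := by
  obtain ⟨S⟩ := nonempty_cutoffFrame (EM := EM) (F := F) (V := V) m
  -- The matrix entries of `Φ` at `m` serve as constant coefficients; every `endSec` has zero anchor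
  -- everywhere, hence so does the combination.
  refine ⟨∑ i, ∑ j, S.coord j m (Φ (S.sec i m)) • S.endSec i (S.sec j), ?_, fun p => ?_⟩
  · simp only [Submodule.coe_sum, Finset.sum_apply]
    refine gaugeFiber_ext (fun u => ?_) ?_
    · change gaugeOpHom m u _ = Φ (u m)
      simp only [map_sum]
      change ∑ i, ∑ j, S.coord j m (Φ (S.sec i m)) • (S.coord i m (u m) • S.sec j m) = _
      have hv : ∀ v : V m, ∑ i, S.coord i m v • S.sec i m = v := fun v => by
        rw [S.sum_coord_smul_sec, S.cut_self, one_smul]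
      have h1 : ∀ i, ∑ j, S.coord j m (Φ (S.sec i m)) • (S.coord i m (u m) • S.sec j m) =
          S.coord i m (u m) • Φ (S.sec i m) := by
        intro i
        conv_rhs => rw [← hv (Φ (S.sec i m)), Finset.smul_sum]
        exact Finset.sum_congr rfl fun j _ => smul_comm _ _ _
      rw [Finset.sum_congr rfl fun i _ => h1 i]
      conv_rhs => rw [← hv (u m), map_sum]
      simp only [map_smul]
    · change gaugeAnchorHom EM F V m _ = 0
      simp only [map_sum]
      refine Finset.sum_eq_zero fun i _ => Finset.sum_eq_zero fun j _ => ?_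
      exact smul_zero (M := ℝ) (A := TangentSpace 𝓘(ℝ, EM) m) _
  · simp only [Submodule.coe_sum, Finset.sum_apply]
    change gaugeAnchorHom EM F V p _ = 0
    simp only [map_sum]
    refine Finset.sum_eq_zero fun i _ => Finset.sum_eq_zero fun j _ => ?_
    exact smul_zero (M := ℝ) (A := TangentSpace 𝓘(ℝ, EM) p) _

end Frames

/-! ### Linearity of the action and of the pairing -/

section Operations

theorem smul_sec_add (f : C^∞⟮𝓘(ℝ, EM), M; ℝ⟯) (u v : Cₛ^∞⟮𝓘(ℝ, EM); F, V⟯) :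
    f • (u + v) = f • u + f • v := by
  ext p; exact smul_add _ _ _

theorem smul_sec_sub (f : C^∞⟮𝓘(ℝ, EM), M; ℝ⟯) (u v : Cₛ^∞⟮𝓘(ℝ, EM); F, V⟯) :
    f • (u - v) = f • u - f • v := by
  ext p; exact smul_sub _ _ _

variable [IsManifold 𝓘(ℝ, EM) ∞ M]

theorem gaugeSec_ext {d r : GaugeSec EM F V} (hop : ∀ u, act d u = act r u)
    (ha : ∀ p, gaugeAnchor (d.1 p) = gaugeAnchor (r.1 p)) : d = r :=
  Subtype.ext (funext fun p => gaugeFiber_ext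
    (fun u => congrArg (fun v : Cₛ^∞⟮𝓘(ℝ, EM); F, V⟯ => v p) (hop u)) (ha p))

theorem act_add_right (d : GaugeSec EM F V) (u v : Cₛ^∞⟮𝓘(ℝ, EM); F, V⟯) :
    act d (u + v) = act d u + act d v := by
  ext p; exact map_add (gaugeOp (d.1 p)) u v

theorem act_sub_right (d : GaugeSec EM F V) (u v : Cₛ^∞⟮𝓘(ℝ, EM); F, V⟯) :
    act d (u - v) = act d u - act d v := by
  ext p; exact map_sub (gaugeOp (d.1 p)) u v

theorem act_const_smul_right (d : GaugeSec EM F V) (c : ℝ) (u : Cₛ^∞⟮𝓘(ℝ, EM); F, V⟯) :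
    act d (c • u) = c • act d u := by
  ext p; exact map_smul (gaugeOp (d.1 p)) c u

theorem act_add_left (d r : GaugeSec EM F V) (u : Cₛ^∞⟮𝓘(ℝ, EM); F, V⟯) :
    act (d + r) u = act d u + act r u := rfl

theorem act_const_smul_left (c : ℝ) (d : GaugeSec EM F V) (u : Cₛ^∞⟮𝓘(ℝ, EM); F, V⟯) :
    act (c • d) u = c • act d u := rfl

theorem act_smul_left (f : C^∞⟮𝓘(ℝ, EM), M; ℝ⟯) (d : GaugeSec EM F V)
    (u : Cₛ^∞⟮𝓘(ℝ, EM); F, V⟯) : act (f • d) u = f • act d u := rfl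

theorem pairing_add_right (μ : JetSec EM F V) (d r : GaugeSec EM F V) :
    pairing μ (d + r) = pairing μ d + pairing μ r := by
  ext p; exact map_add (μ.1 p).1 _ _

theorem pairing_neg_right (μ : JetSec EM F V) (d : GaugeSec EM F V) :
    pairing μ (-d) = -pairing μ d := by
  ext p; exact map_neg (μ.1 p).1 _

theorem pairing_const_smul_right (c : ℝ) (μ : JetSec EM F V) (d : GaugeSec EM F V) :
    pairing μ (c • d) = c • pairing μ d := by
  ext p; exact map_smul (μ.1 p).1 _ _

theorem pairing_smul_right (f : C^∞⟮𝓘(ℝ, EM), M; ℝ⟯) (μ : JetSec EM F V)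
    (d : GaugeSec EM F V) : pairing μ (f • d) = f • pairing μ d := by
  ext p; exact map_smul (μ.1 p).1 _ _

theorem pairing_add_left (μ ν : JetSec EM F V) (d : GaugeSec EM F V) :
    pairing (μ + ν) d = pairing μ d + pairing ν d := rfl

theorem pairing_const_smul_left (c : ℝ) (μ : JetSec EM F V) (d : GaugeSec EM F V) :
    pairing (c • μ) d = c • pairing μ d := rfl

theorem pairing_smul_left (f : C^∞⟮𝓘(ℝ, EM), M; ℝ⟯) (μ : JetSec EM F V)
    (d : GaugeSec EM F V) : pairing (f • μ) d = f • pairing μ d := rfl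

theorem pairing_jetD (u : Cₛ^∞⟮𝓘(ℝ, EM); F, V⟯) (d : GaugeSec EM F V) :
    pairing (jetD u) d = act d u := rfl

variable (EM M) in
theorem isManifold_minSmoothness (k : ℕ) : IsManifold 𝓘(ℝ, EM) (minSmoothness ℝ k) M :=
  IsManifold.of_le (n := ∞) (by
    rw [minSmoothness_of_isRCLikeNormedField]
    exact WithTop.coe_le_coe.2 (le_top : (k : ℕ∞) ≤ ⊤))

theorem mdifferentiableAt_anchor (d : GaugeSec EM F V) (p : M) :
    MDifferentiableAt 𝓘(ℝ, EM) 𝓘(ℝ, EM).tangent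
      (fun m => (⟨m, gaugeAnchor (d.1 m)⟩ : TangentBundle 𝓘(ℝ, EM) M)) p :=
  (d.2.2 p).mdifferentiableAt (by simp)

variable (EM F V) in
/-- The identity section of `gl(E) ⊂ 𝔇E`. -/
def gaugeOne : GaugeSec EM F V :=
  ⟨fun _ => gaugeOfEnd EM F LinearMap.id, fun u => u.contMDiff, (0 : GaugeSec EM F V).2.2⟩

theorem act_gaugeOne (u : Cₛ^∞⟮𝓘(ℝ, EM); F, V⟯) : act (gaugeOne EM F V) u = u := rfl

end Operations

/-! ### The Lie algebroid bracket -/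

section Bracket

variable [FiniteDimensional ℝ EM] [IsManifold 𝓘(ℝ, EM) ∞ M]

theorem act_gaugeBracket (d r : GaugeSec EM F V) (u : Cₛ^∞⟮𝓘(ℝ, EM); F, V⟯) :
    act (gaugeBracket d r) u = act d (act r u) - act r (act d u) := rfl

theorem anchor_gaugeBracket (d r : GaugeSec EM F V) (p : M) :
    gaugeAnchor ((gaugeBracket d r).1 p) = mlieBracket 𝓘(ℝ, EM)
      (fun p => gaugeAnchor (d.1 p)) (fun p => gaugeAnchor (r.1 p)) p := rfl

theorem gaugeBracket_swap (d r : GaugeSec EM F V) : gaugeBracket d r = -gaugeBracket r d := by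
  refine gaugeSec_ext (fun u => ?_) fun p => mlieBracket_swap_apply
  change _ = -(act r (act d u) - act d (act r u))
  rw [act_gaugeBracket, neg_sub]

theorem gaugeBracket_add_right (d r t : GaugeSec EM F V) :
    gaugeBracket d (r + t) = gaugeBracket d r + gaugeBracket d t := by
  have := FiniteDimensional.complete ℝ EM
  have : IsManifold 𝓘(ℝ, EM) (minSmoothness ℝ 2) M := isManifold_minSmoothness EM M 2
  refine gaugeSec_ext (fun u => ?_) fun p =>
    mlieBracket_add_right (mdifferentiableAt_anchor r p) (mdifferentiableAt_anchor t p)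
  simp only [act_gaugeBracket, act_add_left, act_add_right]
  abel

theorem gaugeBracket_smul_right (d r : GaugeSec EM F V) (f : C^∞⟮𝓘(ℝ, EM), M; ℝ⟯) :
    gaugeBracket d (f • r) = f • gaugeBracket d r + anchorDeriv d f • r := by
  have := FiniteDimensional.complete ℝ EM
  have : IsManifold 𝓘(ℝ, EM) (minSmoothness ℝ 2) M := isManifold_minSmoothness EM M 2
  refine gaugeSec_ext (fun u => ?_) fun p =>
    (mlieBracket_smul_right f.mdifferentiableAt (mdifferentiableAt_anchor r p)).trans
      (add_comm _ _)
  simp only [act_gaugeBracket, act_add_left, act_smul_left, act_smul, smul_sec_sub]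
  abel

theorem gaugeBracket_const_smul_right (d r : GaugeSec EM F V) (c : ℝ) :
    gaugeBracket d (c • r) = c • gaugeBracket d r := by
  have := FiniteDimensional.complete ℝ EM
  have : IsManifold 𝓘(ℝ, EM) (minSmoothness ℝ 2) M := isManifold_minSmoothness EM M 2
  refine gaugeSec_ext (fun u => ?_) fun p =>
    mlieBracket_const_smul_right (mdifferentiableAt_anchor r p)
  simp only [act_gaugeBracket, act_const_smul_left, act_const_smul_right, smul_sub]

theorem gaugeBracket_add_left (d r t : GaugeSec EM F V) :
    gaugeBracket (d + r) t = gaugeBracket d t + gaugeBracket r t := by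
  have := FiniteDimensional.complete ℝ EM
  have : IsManifold 𝓘(ℝ, EM) (minSmoothness ℝ 2) M := isManifold_minSmoothness EM M 2
  refine gaugeSec_ext (fun u => ?_) fun p =>
    mlieBracket_add_left (mdifferentiableAt_anchor d p) (mdifferentiableAt_anchor r p)
  simp only [act_gaugeBracket, act_add_left, act_add_right]
  abel

theorem gaugeBracket_const_smul_left (c : ℝ) (d r : GaugeSec EM F V) :
    gaugeBracket (c • d) r = c • gaugeBracket d r := by
  have := FiniteDimensional.complete ℝ EM
  have : IsManifold 𝓘(ℝ, EM) (minSmoothness ℝ 2) M := isManifold_minSmoothness EM M 2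
  refine gaugeSec_ext (fun u => ?_) fun p =>
    mlieBracket_const_smul_left (mdifferentiableAt_anchor d p)
  simp only [act_gaugeBracket, act_const_smul_left, act_const_smul_right, smul_sub]

/-- On operators, `r` acting on `f • act d u` also differentiates `f`. The resulting term stands on
the left so that no subtraction of gauge sections appears. -/
theorem gaugeBracket_smul_left_add (f : C^∞⟮𝓘(ℝ, EM), M; ℝ⟯) (d r : GaugeSec EM F V) :
    gaugeBracket (f • d) r + anchorDeriv r f • d = f • gaugeBracket d r := by
  have := FiniteDimensional.complete ℝ EM
  have : IsManifold 𝓘(ℝ, EM) (minSmoothness ℝ 2) M := isManifold_minSmoothness EM M 2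
  refine gaugeSec_ext (fun u => ?_) fun p => ?_
  · simp only [act_gaugeBracket, act_add_left, act_smul_left, act_smul, smul_sec_sub]
    abel
  · have h := mlieBracket_smul_left (I := 𝓘(ℝ, EM)) (W := fun p => gaugeAnchor (r.1 p))
      (f.mdifferentiableAt (x := p)) (mdifferentiableAt_anchor d p)
    change mlieBracket 𝓘(ℝ, EM) ((f : M → ℝ) • fun p => gaugeAnchor (d.1 p))
        (fun p => gaugeAnchor (r.1 p)) p +
      mvfderiv 𝓘(ℝ, EM) f p (gaugeAnchor (r.1 p)) • gaugeAnchor (d.1 p) =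
      f p • mlieBracket 𝓘(ℝ, EM) (fun p => gaugeAnchor (d.1 p)) (fun p => gaugeAnchor (r.1 p)) p
    rw [h]
    module

theorem pairing_gaugeBracket_smul_left (μ : JetSec EM F V) (f : C^∞⟮𝓘(ℝ, EM), M; ℝ⟯)
    (d r : GaugeSec EM F V) :
    pairing μ (gaugeBracket (f • d) r) =
      f • pairing μ (gaugeBracket d r) - anchorDeriv r f • pairing μ d := by
  rw [eq_sub_iff_add_eq, ← pairing_smul_right, ← pairing_smul_right, ← pairing_add_right,
    gaugeBracket_smul_left_add]

theorem gaugeBracket_self (d : GaugeSec EM F V) : gaugeBracket d d = 0 := by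
  refine gaugeSec_ext (fun u => ?_) fun p => ?_
  · rw [act_gaugeBracket, sub_self]
    rfl
  · rw [anchor_gaugeBracket, mlieBracket_self]
    rfl

/-- The Jacobi identity. -/
theorem gaugeBracket_leibniz (d r t : GaugeSec EM F V) :
    gaugeBracket d (gaugeBracket r t) =
      gaugeBracket (gaugeBracket d r) t + gaugeBracket r (gaugeBracket d t) := by
  have := FiniteDimensional.complete ℝ EM
  have h2 : (minSmoothness ℝ 2) ≤ (∞ : ℕ∞ω) := by
    rw [minSmoothness_of_isRCLikeNormedField]; exact WithTop.coe_le_coe.2 (le_top : (2 : ℕ∞) ≤ ⊤)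
  have : IsManifold 𝓘(ℝ, EM) (minSmoothness ℝ 3) M := isManifold_minSmoothness EM M 3
  refine gaugeSec_ext (fun u => ?_) fun p => leibniz_identity_mlieBracket_apply
    ((d.2.2 p).of_le h2) ((r.2.2 p).of_le h2) ((t.2.2 p).of_le h2)
  simp only [act_gaugeBracket, act_add_left, act_sub_right]
  abel

/-- The Jacobi identity as a rewriting rule: it turns left-nested brackets into right-nested ones,
so that the terms of the Leibniz identity become comparable. -/
theorem pairing_gaugeBracket_gaugeBracket (μ : JetSec EM F V) (d r t : GaugeSec EM F V) :
    pairing μ (gaugeBracket (gaugeBracket d r) t) =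
      pairing μ (gaugeBracket d (gaugeBracket r t)) -
        pairing μ (gaugeBracket r (gaugeBracket d t)) := by
  rw [gaugeBracket_leibniz d, pairing_add_right, add_sub_cancel_right]

theorem fst_dorfman (X Y : OmniSec EM F V) : (dorfman X Y).1 = gaugeBracket X.1 Y.1 := rfl

end Bracket

/-! ### Existence of the Lie derivative -/

section LieDerivative

variable [FiniteDimensional ℝ EM] [T2Space M] [IsManifold 𝓘(ℝ, EM) ∞ M]
  [FiniteDimensional ℝ F] [ContMDiffVectorBundle ∞ F V 𝓘(ℝ, EM)]

/-- A section of `𝔍E` pairs with a section of `gl(E)` through its value on the identity. -/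
theorem pairing_eq_act_of_anchor_eq_zero (μ : JetSec EM F V) {r : GaugeSec EM F V}
    (hr : ∀ p, gaugeAnchor (r.1 p) = 0) :
    pairing μ r = act r (pairing μ (gaugeOne EM F V)) := by
  ext p
  obtain ⟨Φ, hΦ⟩ := exists_eq_gaugeOfEnd (hr p)
  change (μ.1 p).1 (r.1 p) = gaugeOp (r.1 p) (pairing μ (gaugeOne EM F V))
  rw [hΦ]
  exact (μ.1 p).2 Φ

/-- The prescribed right-hand side is `C^∞(M)`-linear in `r`, because the derivatives of `f` along
the anchor of `d` from its two terms cancel; so it is given fibrewise. What remains is the jet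
condition on the fibres, while smoothness is automatic. -/
theorem exists_isLieDerivative (d : GaugeSec EM F V) (μ : JetSec EM F V) :
    ∃ ν, IsLieDerivative d μ ν := by
  let L : GaugeSec EM F V →+ Cₛ^∞⟮𝓘(ℝ, EM); F, V⟯ :=
    AddMonoidHom.mk' (fun r => act d (pairing μ r) - pairing μ (gaugeBracket d r)) fun r t => by
      simp only [pairing_add_right, gaugeBracket_add_right, act_add_right]
      abel
  have hL : ∀ r, L r = act d (pairing μ r) - pairing μ (gaugeBracket d r) := fun _ => rfl
  obtain ⟨ν, hν⟩ := exists_fiberwise_of_smul L fun f r => by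
    simp only [hL, pairing_smul_right, gaugeBracket_smul_right, act_smul, pairing_add_right,
      smul_sec_sub]
    abel
  -- For `r` in `gl(E)` the bracket `[d, r]` is again in `gl(E)`, so both pairings are actions on
  -- `μ(1)`, and `d r - [d, r] = r d` as operators.
  have hEnd : ∀ r : GaugeSec EM F V, (∀ p, gaugeAnchor (r.1 p) = 0) →
      L r = act r (act d (pairing μ (gaugeOne EM F V))) := by
    intro r hr
    have hb : ∀ p, gaugeAnchor ((gaugeBracket d r).1 p) = 0 := by
      intro p
      have h0 : (fun p => gaugeAnchor (r.1 p)) = 0 := funext hr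
      rw [anchor_gaugeBracket, h0, mlieBracket_zero_right]
      rfl
    rw [hL, pairing_eq_act_of_anchor_eq_zero μ hr, pairing_eq_act_of_anchor_eq_zero μ hb,
      act_gaugeBracket, sub_sub_cancel]
  refine ⟨⟨fun m => ⟨ν m, fun Φ => ?_⟩, fun r => ?_⟩, fun r => ?_⟩
  -- The jet condition at `m` is `hEnd` for a section of `gl(E)` through `Φ`, compared with `hEnd`
  -- for the identity section.
  · obtain ⟨r, hr, hr0⟩ := exists_gaugeSec_eq_gaugeOfEnd (EM := EM) (F := F) Φ
    have h1 := hν (gaugeOne EM F V) m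
    rw [hEnd _ fun _ => rfl, act_gaugeOne] at h1
    have h2 := hν r m
    rw [hEnd r hr0, hr] at h2
    rw [← h2]
    change gaugeOp (r.1 m) _ = Φ (ν m ((gaugeOne EM F V).1 m))
    rw [← h1, hr]
    rfl
  · have h : (fun m => TotalSpace.mk' F m (ν m (r.1 m))) = fun m => TotalSpace.mk' F m (L r m) :=
      funext fun m => by rw [hν]
    change ContMDiff _ _ _ (fun m => TotalSpace.mk' F m (ν m (r.1 m)))
    rw [h]
    exact (L r).contMDiff
  · ext m
    exact (hν r m).symm

theorem isLieDerivative_lieDerivative (d : GaugeSec EM F V) (μ : JetSec EM F V) :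
    IsLieDerivative d μ (lieDerivative d μ) := by
  have h := exists_isLieDerivative d μ
  rw [lieDerivative, dif_pos h]
  exact h.choose_spec

theorem pairing_lieDerivative (d : GaugeSec EM F V) (μ : JetSec EM F V) (r : GaugeSec EM F V) :
    pairing (lieDerivative d μ) r = act d (pairing μ r) - pairing μ (gaugeBracket d r) :=
  isLieDerivative_lieDerivative d μ r

end LieDerivative

/-! ### The Dorfman bracket identities -/

section Dorfman

variable [FiniteDimensional ℝ EM] [T2Space M] [IsManifold 𝓘(ℝ, EM) ∞ M]
  [FiniteDimensional ℝ F] [ContMDiffVectorBundle ∞ F V 𝓘(ℝ, EM)]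

theorem omniSec_ext {X Y : OmniSec EM F V} (h₁ : X.1 = Y.1)
    (h₂ : ∀ r, pairing X.2 r = pairing Y.2 r) : X = Y :=
  Prod.ext h₁ (jetSec_ext h₂)

/-- The pairing of the jet part of the Dorfman bracket with a section of `𝔇E`. -/
theorem pairing_dorfman (X Y : OmniSec EM F V) (s : GaugeSec EM F V) :
    pairing (dorfman X Y).2 s =
      act X.1 (pairing Y.2 s) - pairing Y.2 (gaugeBracket X.1 s) -
        (act Y.1 (pairing X.2 s) - pairing X.2 (gaugeBracket Y.1 s)) +
        act s (pairing X.2 Y.1) := by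
  rw [← pairing_lieDerivative, ← pairing_lieDerivative]
  rfl

theorem isLeibnizAlgebra_dorfman :
    IsLeibnizAlgebra (dorfman : OmniSec EM F V → OmniSec EM F V → OmniSec EM F V) where
  add_left X Y Z := omniSec_ext (gaugeBracket_add_left _ _ _) fun s => by
    simp only [pairing_dorfman, Prod.fst_add, Prod.snd_add, pairing_add_left, pairing_add_right,
      act_add_left, act_add_right, gaugeBracket_add_left]
    abel
  smul_left c X Y := omniSec_ext (gaugeBracket_const_smul_left _ _ _) fun s => by
    simp only [pairing_dorfman, Prod.smul_fst, Prod.smul_snd, pairing_const_smul_left,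
      pairing_const_smul_right, act_const_smul_left, act_const_smul_right,
      gaugeBracket_const_smul_left, smul_sub, smul_add]
  add_right X Y Z := omniSec_ext (gaugeBracket_add_right _ _ _) fun s => by
    simp only [pairing_dorfman, Prod.fst_add, Prod.snd_add, pairing_add_left, pairing_add_right,
      act_add_left, act_add_right, gaugeBracket_add_left]
    abel
  smul_right c X Y := omniSec_ext (gaugeBracket_const_smul_right _ _ _) fun s => by
    simp only [pairing_dorfman, Prod.smul_fst, Prod.smul_snd, pairing_const_smul_left,
      pairing_const_smul_right, act_const_smul_left, act_const_smul_right,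
      gaugeBracket_const_smul_left, smul_sub, smul_add]
  leibniz X Y Z := omniSec_ext (gaugeBracket_leibniz _ _ _) fun s => by
    simp only [pairing_dorfman, Prod.snd_add, pairing_add_left, fst_dorfman, act_add_right,
      act_sub_right, act_gaugeBracket, pairing_gaugeBracket_gaugeBracket]
    abel

/-- Against a test section `s`, the derivative of `f` along `s` occurs twice, from the bracket `[f •
Y.1, s]` and from the exact term, with opposite signs. Only the derivative along `X` survives. -/
theorem dorfman_smul (X Y : OmniSec EM F V) (f : C^∞⟮𝓘(ℝ, EM), M; ℝ⟯) :
    dorfman X (f • Y) = f • dorfman X Y + anchorDeriv (rho X) f • Y := by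
  refine omniSec_ext (gaugeBracket_smul_right _ _ _) fun s => ?_
  simp only [pairing_dorfman, Prod.smul_fst, Prod.smul_snd, Prod.snd_add, pairing_add_left,
    pairing_smul_left, pairing_smul_right, act_smul_left, act_smul,
    pairing_gaugeBracket_smul_left, smul_sec_add, smul_sec_sub, rho]
  abel

/-- The two Lie derivatives cancel, leaving the exact term; the factor one half in the pairing
compensates for its two equal summands. -/
theorem dorfman_self (X : OmniSec EM F V) :
    dorfman X X = ((0 : GaugeSec EM F V), jetD (omniPairing X X)) := by
  refine omniSec_ext (gaugeBracket_self _) fun s => ?_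
  simp only [pairing_dorfman, pairing_jetD, omniPairing, act_const_smul_right, act_add_right]
  module

/-- The terms containing `X.2` are antisymmetric under exchange of `Y` and `Z` and cancel in the
sum, once `[Z.1, Y.1]` is turned into `-[Y.1, Z.1]`. The pairings with `[X.1, Y.1]` and `[X.1, Z.1]`
cancel against those from the Lie derivatives along `X.1`. -/
theorem act_omniPairing (X Y Z : OmniSec EM F V) :
    act (rho X) (omniPairing Y Z) =
      omniPairing (dorfman X Y) Z + omniPairing Y (dorfman X Z) := by
  simp only [omniPairing, pairing_dorfman, fst_dorfman, act_const_smul_right, act_add_right, rho,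
    gaugeBracket_swap Z.1 Y.1, pairing_neg_right]
  module

end Dorfman

end

end OmniLie

theorem mainTheorem4
    {EM : Type*} [NormedAddCommGroup EM] [NormedSpace ℝ EM] [FiniteDimensional ℝ EM]
    {M : Type*} [TopologicalSpace M] [T2Space M] [ChartedSpace EM M] [IsManifold 𝓘(ℝ, EM) ∞ M]
    {F : Type*} [NormedAddCommGroup F] [NormedSpace ℝ F] [FiniteDimensional ℝ F]
    {V : M → Type*} [TopologicalSpace (TotalSpace F V)]
    [∀ m, AddCommGroup (V m)] [∀ m, Module ℝ (V m)] [∀ m, TopologicalSpace (V m)]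
    [FiberBundle F V] [VectorBundle ℝ F V] [ContMDiffVectorBundle ∞ F V 𝓘(ℝ, EM)] :
    -- the Lie derivative entering the bracket is well defined, with values in `Γ(𝔍E)`
    (∀ (d : OmniLie.GaugeSec EM F V) (μ : OmniLie.JetSec EM F V),
      OmniLie.IsLieDerivative d μ (OmniLie.lieDerivative d μ) ∧
        ∀ ν, OmniLie.IsLieDerivative d μ ν → ν = OmniLie.lieDerivative d μ) ∧
    OmniLie.IsLeibnizAlgebra
      (OmniLie.dorfman : OmniLie.OmniSec EM F V → OmniLie.OmniSec EM F V →
        OmniLie.OmniSec EM F V) ∧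
    (∀ X Y : OmniLie.OmniSec EM F V,
      OmniLie.rho (OmniLie.dorfman X Y) =
        OmniLie.gaugeBracket (OmniLie.rho X) (OmniLie.rho Y)) ∧
    (∀ (X Y : OmniLie.OmniSec EM F V) (f : C^∞⟮𝓘(ℝ, EM), M; ℝ⟯),
      OmniLie.dorfman X (f • Y) =
        f • OmniLie.dorfman X Y + OmniLie.anchorDeriv (OmniLie.rho X) f • Y) ∧
    (∀ X : OmniLie.OmniSec EM F V,
      OmniLie.dorfman X X =
        ((0 : OmniLie.GaugeSec EM F V), OmniLie.jetD (OmniLie.omniPairing X X))) ∧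
    (∀ X Y Z : OmniLie.OmniSec EM F V,
      OmniLie.act (OmniLie.rho X) (OmniLie.omniPairing Y Z) =
        OmniLie.omniPairing (OmniLie.dorfman X Y) Z +
          OmniLie.omniPairing Y (OmniLie.dorfman X Z)) := by
  exact ⟨fun d μ => ⟨OmniLie.isLieDerivative_lieDerivative d μ, fun ν hν =>
      OmniLie.jetSec_ext fun r => (hν r).trans (OmniLie.pairing_lieDerivative d μ r).symm⟩,
    OmniLie.isLeibnizAlgebra_dorfman, fun _ _ => rfl, OmniLie.dorfman_smul,
    OmniLie.dorfman_self, OmniLie.act_omniPairing⟩
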